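/- Let $\mathcal G$ be a locally compact Hausdorff étale groupoid with unit space $\mathcal G^{(0)}$ and range and source maps $r,s$, and suppose that $\mathcal G$ is principal, i.e. $\gamma\mapsto(r(\gamma),s(\gamma))$ is injective on $\mathcal G$. For $x\in\mathcal G^{(0)}$ let $\mathcal G_x=\{\gamma\in\mathcal G: s(\gamma)=x\}$, and for $f\in C_c(\mathcal G)$ let $\pi_x(f)$ be the operator on $\ell^2(\mathcal G_x)$ given by $\langle\delta_\gamma,\pi_x(f)\delta_\alpha\rangle=f(\gamma\alpha^{-1})$ for $\alpha,\gamma\in\mathcal G_x$ (inner product linear in the second variable). The reduced $C^*$-algebra $C^*_r(\mathcal G)$ is the norm closure of $\{(\pi_x(f))_x : f\in C_c(\mathcal G)\}$ in the $\ell^\infty$-product $\prod_{x\in\mathcal G^{(0)}}B(\ell^2(\mathcal G_x))$. It contains $C_0(\mathcal G^{(0)})$, where $f\in C_0(\mathcal G^{(0)})$ acts on each $\ell^2(\mathcal G_x)$ as multiplication by the function $\gamma\mapsto f(r(\gamma))$. An element $a=(a_x)_x\in C^*_r(\mathcal G)$ defines a function on $\mathcal G$ by $a(\gamma)=\langle\delta_\gamma,a_{s(\gamma)}\delta_{s(\gamma)}\rangle$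 (this is the canonical embedding $C^*_r(\mathcal G)\to C_0(\mathcal G)$), and its open support is $\mathrm{supp}^\circ(a)=\{\gamma\in\mathcal G: a(\gamma)\ne0\}$. Let $a\in C^*_r(\mathcal G)$. Then: 1. $a$ is an $r$-normalizer of $C_0(\mathcal G^{(0)})$, i.e. $a^*C_0(\mathcal G^{(0)})a\subseteq C_0(\mathcal G^{(0)})$, if and only if $\mathrm{supp}^\circ(a)$ is an $r$-section, i.e. $r$ is injective on $\mathrm{supp}^\circ(a)$. 2. $a$ is an $s$-normalizer of $C_0(\mathcal G^{(0)})$, i.e. $aC_0(\mathcal G^{(0)})a^*\subseteq C_0(\mathcal G^{(0)})$, if and only if $\mathrm{supp}^\circ(a)$ is an $s$-section, i.e. $s$ is injective on $\mathrm{supp}^\circ(a)$. -/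

import Mathlib

open CategoryTheory
open scoped ENNReal CompactlySupported ZeroAtInfty

universe u v

/-! ## Étale groupoids

A groupoid is a small category all of whose morphisms are invertible.  Its unit space is the type of
objects `X`, and the groupoid itself (as a set) is the type of all arrows `Quiver.Total X`.
An arrow `γ : x ⟶ y` has source `x` and range `y`, so the groupoid product `α β`, defined when
`s α = r β`, is the categorical composite `β ≫ α`. -/

namespace EtaleGpd

/-- The set of all arrows of the groupoid. -/
abbrev Arrows (X : Type u) [Groupoid.{v} X] : Type (max u v) := Quiver.Total X

section Basic

variable {X : Type u} [Groupoid.{v} X]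

/-- The source map. -/
def src (γ : Arrows X) : X := γ.left

/-- The range map. -/
def rng (γ : Arrows X) : X := γ.right

/-- The inclusion of the unit space in the groupoid. -/
def unit (x : X) : Arrows X := ⟨x, x, 𝟙 x⟩

/-- The inverse map. -/
def inverse (γ : Arrows X) : Arrows X := ⟨γ.right, γ.left, Groupoid.inv γ.hom⟩

/-- The product `α β` of a composable pair, that is, of arrows with `s α = r β`. -/
def prod (α β : Arrows X) (h : src α = rng β) : Arrows X :=
  ⟨β.left, α.right, β.hom ≫ eqToHom h.symm ≫ α.hom⟩

/-- An `r`-section: a set of arrows on which the range map is injective. -/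
def IsRSection (A : Set (Arrows X)) : Prop := Set.InjOn rng A

/-- An `s`-section: a set of arrows on which the source map is injective. -/
def IsSSection (A : Set (Arrows X)) : Prop := Set.InjOn src A

end Basic

/-- The groupoid is principal: an arrow is determined by its range and its source. -/
def IsPrincipal (X : Type u) [Groupoid.{v} X] : Prop :=
  Function.Injective fun γ : Arrows X => (rng γ, src γ)

/-- A topological groupoid: the structure maps are continuous.  Since `src ∘ unit = id`, the
topology of `X` is then the one induced from the space of arrows. -/
class IsTopologicalGroupoid (X : Type u) [Groupoid.{v} X] [TopologicalSpace X]
    [TopologicalSpace (Arrows X)] : Prop where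
  continuous_src : Continuous (src : Arrows X → X)
  continuous_rng : Continuous (rng : Arrows X → X)
  continuous_unit : Continuous (unit : X → Arrows X)
  continuous_inverse : Continuous (inverse : Arrows X → Arrows X)
  continuous_prod : Continuous fun p : {p : Arrows X × Arrows X // src p.1 = rng p.2} =>
    prod p.1.1 p.1.2 p.2

/-- An étale groupoid: a topological groupoid whose range map is a local homeomorphism. -/
class IsEtaleGroupoid (X : Type u) [Groupoid.{v} X] [TopologicalSpace X]
    [TopologicalSpace (Arrows X)] : Prop extends IsTopologicalGroupoid X where
  isLocalHomeomorph_rng : IsLocalHomeomorph (rng : Arrows X → X)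

/-! ## The reduced C*-algebra -/

/-- The Hilbert space `ℓ²(𝒢_x)`, where `𝒢_x = Quiver.Star x` is the set of arrows with source `x`. -/
abbrev FibreSpace {X : Type u} [Groupoid.{v} X] (x : X) : Type (max u v) :=
  lp (fun _ : Quiver.Star x => ℂ) 2

open scoped Classical in
/-- The canonical basis vector `δ_γ` of `ℓ²(𝒢_x)`. -/
noncomputable def delta {X : Type u} [Groupoid.{v} X] {x : X} (γ : Quiver.Star x) :
    FibreSpace x :=
  lp.single 2 γ (1 : ℂ)

/-- The `ℓ^∞`-product C*-algebra `∏ₓ B(ℓ²(𝒢_x))` over all units `x`: bounded families of operators,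
with pointwise operations and norm `‖T‖ = supₓ ‖T x‖`. -/
def FibreOperators (X : Type u) [Groupoid.{v} X] : Type (max u v) :=
  lp (fun x : X => FibreSpace x →L[ℂ] FibreSpace x) ∞

noncomputable instance (X : Type u) [Groupoid.{v} X] : NonUnitalCStarAlgebra (FibreOperators X) :=
  inferInstanceAs
    (NonUnitalCStarAlgebra (lp (fun x : X => FibreSpace x →L[ℂ] FibreSpace x) ∞))

/-- The component at the unit `x` of a family of operators. -/
def FibreOperators.at {X : Type u} [Groupoid.{v} X] (T : FibreOperators X) (x : X) :
    FibreSpace x →L[ℂ] FibreSpace x :=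
  (show lp (fun x : X => FibreSpace x →L[ℂ] FibreSpace x) ∞ from T) x

namespace FibreOperators

variable {X : Type u} [Groupoid.{v} X] (S T : FibreOperators X) (x : X)

@[simp] theorem zero_at : (0 : FibreOperators X).at x = 0 := rfl

@[simp] theorem add_at : (S + T).at x = S.at x + T.at x := rfl

@[simp] theorem mul_at : (S * T).at x = S.at x * T.at x := rfl

@[simp] theorem smul_at (c : ℂ) : (c • T).at x = c • T.at x := rfl

@[simp] theorem star_at : (star T).at x = ContinuousLinearMap.adjoint (T.at x) := rfl

theorem norm_eq : ‖T‖ = ⨆ x, ‖T.at x‖ := rfl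

end FibreOperators

/-- `T` is the family `(π_x(f))ₓ` of left regular representations of `f`.  Here `π_x(f)` is left
convolution by `f` on `ℓ²(𝒢_x)`, i.e. `π_x(f) δ_α = ∑ f(β) δ_{β α}`, the sum over all `β` with
`s β = r α`; its coefficient at `γ ∈ 𝒢_x` is `f(γ α⁻¹)`. -/
def IsRegularRep {X : Type u} [Groupoid.{v} X] (f : Arrows X → ℂ) (T : FibreOperators X) : Prop :=
  ∀ (x : X) (α γ : Quiver.Star x),
    T.at x (delta α) γ = f ⟨α.1, γ.1, Groupoid.inv α.2 ≫ γ.2⟩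

/-- `T` is the image of the function `f` on the unit space: it acts on `ℓ²(𝒢_x)` as multiplication
by `γ ↦ f(r γ)`, which is left convolution by `f` extended by zero off the units. -/
def IsMultiplication {X : Type u} [Groupoid.{v} X] (f : X → ℂ) (T : FibreOperators X) : Prop :=
  ∀ (x : X) (ξ : FibreSpace x) (γ : Quiver.Star x), T.at x ξ γ = f γ.1 * ξ γ

open scoped Classical in
theorem IsMultiplication.star {X : Type u} [Groupoid.{v} X] {f : X → ℂ}
    {T : FibreOperators X} (h : IsMultiplication f T) :
    IsMultiplication (star f) (star T) := by
  intro x ξ γ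
  have h1 : ∀ η : FibreSpace x, inner ℂ (delta γ) η = η γ := by
    intro η
    have := lp.inner_single_left (𝕜 := ℂ) (G := fun _ : Quiver.Star x => ℂ) γ (1 : ℂ) η
    simpa [delta] using this
  have h2 : T.at x (delta γ) = f γ.1 • delta γ := by
    apply lp.ext
    funext β
    rw [h x]
    by_cases hb : β = γ
    · subst hb
      simp
    · simp [delta, hb]
  rw [← h1, FibreOperators.star_at, ContinuousLinearMap.adjoint_inner_right, h2,
    inner_smul_left, h1]
  simp

section Reduced

variable (X : Type u) [Groupoid.{v} X] [TopologicalSpace X] [TopologicalSpace (Arrows X)]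

/-- The reduced C*-algebra `C*_r(𝒢)`: the closed `*`-subalgebra of `∏ₓ B(ℓ²(𝒢_x))` generated by the
operators `(π_x(f))ₓ`, for `f` a continuous compactly supported function on the groupoid.  This is
the completion of the convolution algebra `C_c(𝒢)` in the norm `supₓ ‖π_x(f)‖`. -/
noncomputable def ReducedCStarAlgebra : NonUnitalStarSubalgebra ℂ (FibreOperators X) :=
  (NonUnitalStarAlgebra.adjoin ℂ
    {T : FibreOperators X | ∃ f : C_c(Arrows X, ℂ), IsRegularRep f T}).topologicalClosure

variable {X}

/-- The value at the arrow `γ` of the function on the groupoid associated with `a`, under the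
canonical embedding `C*_r(𝒢) → C₀(𝒢)`: for `x = s γ` it is `⟨δ_γ, π_x(a) δ_x⟩`. -/
noncomputable def coeff (a : ReducedCStarAlgebra X) (γ : Arrows X) : ℂ :=
  (a : FibreOperators X).at γ.left (delta (⟨γ.left, 𝟙 γ.left⟩ : Quiver.Star γ.left))
    ⟨γ.right, γ.hom⟩

/-- The open support of `a`, a set of arrows. -/
def openSupport (a : ReducedCStarAlgebra X) : Set (Arrows X) := {γ | coeff a γ ≠ 0}

variable (X)

/-- The canonical copy of `C₀(𝒢⁽⁰⁾)` in `C*_r(𝒢)`. -/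
noncomputable def diagonal : NonUnitalStarSubalgebra ℂ (ReducedCStarAlgebra X) where
  carrier := {T | ∃ f : C₀(X, ℂ), IsMultiplication f (T : FibreOperators X)}
  add_mem' := by
    rintro S T ⟨f, hf⟩ ⟨g, hg⟩
    refine ⟨f + g, fun x ξ γ => ?_⟩
    have h1 := hf x ξ γ
    have h2 := hg x ξ γ
    simp [h1, h2, add_mul]
  zero_mem' := ⟨0, fun x ξ γ => by simp⟩
  mul_mem' := by
    rintro S T ⟨f, hf⟩ ⟨g, hg⟩
    refine ⟨f * g, fun x ξ γ => ?_⟩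
    have h2 := hg x ξ γ
    have h1 := hf x ((T : FibreOperators X).at x ξ) γ
    simp [h1, h2, mul_assoc]
  smul_mem' := by
    rintro c T ⟨f, hf⟩
    refine ⟨c • f, fun x ξ γ => ?_⟩
    have h1 := hf x ξ γ
    simp [h1, mul_assoc]
  star_mem' := by
    rintro T ⟨f, hf⟩
    exact ⟨star f, hf.star⟩

end Reduced

end EtaleGpd

/-! ## One-sided normalizers -/

/-- `a` is an `r`-normalizer of the `*`-subalgebra `D`: `a* D a ⊆ D`. -/
def IsRNormalizer {A : Type*} [NonUnitalSemiring A] [Module ℂ A] [Star A]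
    (D : NonUnitalStarSubalgebra ℂ A) (a : A) : Prop :=
  ∀ d ∈ D, star a * d * a ∈ D

/-- `a` is an `s`-normalizer of the `*`-subalgebra `D`: `a D a* ⊆ D`. -/
def IsSNormalizer {A : Type*} [NonUnitalSemiring A] [Module ℂ A] [Star A]
    (D : NonUnitalStarSubalgebra ℂ A) (a : A) : Prop :=
  ∀ d ∈ D, a * d * star a ∈ D

/-!
Every element `a` of the reduced C*-algebra of an étale groupoid acts on each `ℓ²(𝒢_x)` by left
convolution with its coefficient function, `⟨δ_γ, a δ_α⟩ = a(γ α⁻¹)` (`isRegularRep_coeff`), and that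
function restricts to an element of `C₀(𝒢⁽⁰⁾)` (`coeffUnits`).  Both facts pass to norm limits from
the operators given by `C_c(𝒢)`, which already form a `*`-algebra because `C_c(𝒢)` is closed under
convolution (`exists_convolution`): a partition of unity reduces this to a right factor supported
in an open bisection, where the convolution sum has at most one nonzero term.

If `d` acts as multiplication by `f`, then for `α, γ ∈ 𝒢_x`
`⟨δ_γ, a* d a δ_α⟩ = ∑_β conj (a(β γ⁻¹)) f(r β) a(β α⁻¹)`, summed over `β ∈ 𝒢_x`
(`IsMultiplication.hasSum_conj`).

* If the open support of `a` is an `r`-section, all terms vanish for `γ ≠ α`, since `β γ⁻¹` and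
  `β α⁻¹` have the same range.  Hence `a* d a` is multiplication by the restriction of its
  coefficient function to the units, which lies in `C₀(𝒢⁽⁰⁾)`.
* If `a` is an `r`-normalizer, the sum vanishes for `γ ≠ α` and every bump function `f` on the unit
  space.  Principality makes `r` injective on `𝒢_x`, so letting `f` concentrate at a single `r(β)`
  shows that each product `conj (a(β γ⁻¹)) a(β α⁻¹)` is zero
  (`mul_coeff_eq_zero_of_isRNormalizer`).  Two distinct arrows of the open support with the same
  range would give such a product that is nonzero.

The statement on `s`-normalizers is the one on `r`-normalizers for `a*`, whose open support consists
of the inverses of the arrows in the open support of `a`.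
-/

namespace EtaleGpd

/-! ### Topology of an étale groupoid -/

section Topology

variable {X : Type u} [Groupoid.{v} X]

@[simp] theorem inverse_inverse (γ : Arrows X) : inverse (inverse γ) = γ := by
  obtain ⟨x, y, g⟩ := γ
  simp [inverse]

theorem prod_div_cancel (γ β : Arrows X) (h : src γ = rng (inverse β)) :
    prod (prod γ (inverse β) h) β rfl = γ := by
  obtain ⟨x, y, g⟩ := γ
  obtain ⟨x', z, b⟩ := β
  obtain rfl : x = x' := h
  have hg : b ≫ 𝟙 z ≫ Groupoid.inv b ≫ 𝟙 x ≫ g = g := by simp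
  exact congrArg (fun d => (⟨x, y, d⟩ : Arrows X)) hg

variable [TopologicalSpace X] [TopologicalSpace (Arrows X)]

theorem t2Space_units [IsTopologicalGroupoid X] [T2Space (Arrows X)] : T2Space X :=
  T2Space.of_injective_continuous (f := (unit : X → Arrows X))
    (fun _ _ h => congrArg src h) IsTopologicalGroupoid.continuous_unit

variable [IsEtaleGroupoid X]

variable (X) in
theorem isLocalHomeomorph_src : IsLocalHomeomorph (src : Arrows X → X) := by
  have hc : Continuous (inverse : Arrows X → Arrows X) := IsTopologicalGroupoid.continuous_inverse
  let e : Arrows X ≃ₜ Arrows X :=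
    { toFun := inverse
      invFun := inverse
      left_inv := inverse_inverse
      right_inv := inverse_inverse
      continuous_toFun := hc
      continuous_invFun := hc }
  exact (IsEtaleGroupoid.isLocalHomeomorph_rng (X := X)).comp e.isLocalHomeomorph

variable (X) in
/-- The unit map is a section of the local homeomorphism `rng`, hence open. -/
theorem isOpenEmbedding_unit : Topology.IsOpenEmbedding (unit : X → Arrows X) := by
  have h : IsLocalHomeomorph (unit : X → Arrows X) :=
    IsLocalHomeomorph.of_comp (g := rng) (Homeomorph.refl X).isLocalHomeomorph
      IsEtaleGroupoid.isLocalHomeomorph_rng IsTopologicalGroupoid.continuous_unit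
  exact .of_continuous_injective_isOpenMap h.continuous (fun _ _ h => congrArg src h) h.isOpenMap

theorem locallyCompactSpace_units [LocallyCompactSpace (Arrows X)] : LocallyCompactSpace X :=
  (isOpenEmbedding_unit X).locallyCompactSpace

end Topology

/-! ### Convolution of compactly supported functions -/

section Convolution

variable {X : Type u} [Groupoid.{v} X]

open scoped Classical in
/-- The function `(γ, β) ↦ f (γ β⁻¹)`, extended by zero to the pairs with `s γ ≠ s β`. -/
noncomputable def divKernel (f : Arrows X → ℂ) (γ β : Arrows X) : ℂ :=
  if h : src γ = rng (inverse β) then f (prod γ (inverse β) h) else 0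

theorem divKernel_of_star (f : Arrows X → ℂ) (γ : Arrows X) (β : Quiver.Star γ.left) :
    divKernel f γ ⟨γ.left, β.1, β.2⟩ = f ⟨β.1, γ.right, Groupoid.inv β.2 ≫ γ.hom⟩ := by
  simp [divKernel, prod, inverse, src, rng]

variable [TopologicalSpace X] [TopologicalSpace (Arrows X)]

theorem continuousOn_divKernel [IsTopologicalGroupoid X] {f : Arrows X → ℂ} (hf : Continuous f)
    {σ : X → Arrows X} {V : Set X} (hσ : ContinuousOn σ V) (hs : ∀ x ∈ V, src (σ x) = x) :
    ContinuousOn (fun γ => divKernel f γ (σ (src γ))) (src ⁻¹' V) := by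
  have hsrc : Continuous (src : Arrows X → X) := IsTopologicalGroupoid.continuous_src
  have hinv : Continuous (inverse : Arrows X → Arrows X) :=
    IsTopologicalGroupoid.continuous_inverse
  have hprod := IsTopologicalGroupoid.continuous_prod (X := X)
  rw [continuousOn_iff_continuous_domRestrict]
  have hσ' : Continuous fun γ : (src ⁻¹' V : Set (Arrows X)) => σ (src γ.1) :=
    hσ.comp_continuous (hsrc.comp continuous_subtype_val) fun γ => γ.2
  have h : ∀ γ : (src ⁻¹' V : Set (Arrows X)), src γ.1 = rng (inverse (σ (src γ.1))) :=
    fun γ => (hs _ γ.2).symm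
  have key : (src ⁻¹' V : Set (Arrows X)).domRestrict (fun γ => divKernel f γ (σ (src γ))) =
      fun γ => f (prod γ.1 (inverse (σ (src γ.1))) (h γ)) := by
    funext γ
    simp only [Set.domRestrict_apply, divKernel]
    exact dif_pos (h γ)
  rw [key]
  exact hf.comp (hprod.comp (Continuous.subtype_mk
    (continuous_subtype_val.prodMk (hinv.comp hσ')) h))

variable [T2Space (Arrows X)]

/-- The set `K L` of products of composable pairs from two compact sets is compact. -/
theorem isCompact_products [IsTopologicalGroupoid X] {K L : Set (Arrows X)} (hK : IsCompact K)
    (hL : IsCompact L) :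
    IsCompact {γ : Arrows X | ∃ α ∈ K, ∃ β ∈ L, ∃ h : src α = rng β, prod α β h = γ} := by
  have := t2Space_units (X := X)
  have hsrc : Continuous (src : Arrows X → X) := IsTopologicalGroupoid.continuous_src
  have hrng : Continuous (rng : Arrows X → X) := IsTopologicalGroupoid.continuous_rng
  have hD : IsClosed {p : Arrows X × Arrows X | src p.1 = rng p.2} :=
    isClosed_eq (hsrc.comp continuous_fst) (hrng.comp continuous_snd)
  have hc := hD.isClosedEmbedding_subtypeVal.isCompact_preimage (hK.prod hL)
  convert hc.image (IsTopologicalGroupoid.continuous_prod (X := X)) using 1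
  ext γ
  constructor
  · rintro ⟨α, hα, β, hβ, h, rfl⟩
    exact ⟨⟨(α, β), h⟩, ⟨hα, hβ⟩, rfl⟩
  · rintro ⟨⟨⟨α, β⟩, h⟩, ⟨hα, hβ⟩, rfl⟩
    exact ⟨α, hα, β, hβ, h, rfl⟩

/-- If `g` is supported in an open bisection, the convolution `f * g` is continuous and compactly
supported: with `σ` the inverse of the source map on the bisection, its value at `γ` is
`f (γ σ(s γ)⁻¹) g (σ(s γ))`. -/
theorem exists_convolution_of_bisection [IsTopologicalGroupoid X] (f g : C_c(Arrows X, ℂ))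
    (e : OpenPartialHomeomorph (Arrows X) X) (he : src = e) (hg : tsupport g ⊆ e.source) :
    ∃ k : C_c(Arrows X, ℂ), ∀ γ : Arrows X,
      HasSum (fun β : Quiver.Star γ.left =>
        f ⟨β.1, γ.right, Groupoid.inv β.2 ≫ γ.hom⟩ * g ⟨γ.left, β.1, β.2⟩) (k γ) := by
  classical
  have := t2Space_units (X := X)
  have hsrc : Continuous (src : Arrows X → X) := IsTopologicalGroupoid.continuous_src
  have hs : ∀ x ∈ e.target, src (e.symm x) = x := fun x hx => by rw [he]; exact e.right_inv hx
  have hσ : ∀ β : Arrows X, g β ≠ 0 → src β ∈ e.target ∧ e.symm (src β) = β := fun β hβ => by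
    have := hg (subset_tsupport _ hβ)
    rw [he]
    exact ⟨e.map_source this, e.left_inv this⟩
  let O : Set (Arrows X) := src ⁻¹' e.target
  let k : Arrows X → ℂ :=
    O.indicator fun γ => divKernel f γ (e.symm (src γ)) * g (e.symm (src γ))
  have hO : IsOpen O := e.open_target.preimage hsrc
  let C : Set (Arrows X) := src ⁻¹' (src '' tsupport g)
  have hC : IsClosed C := (g.hasCompactSupport.isCompact.image hsrc).isClosed.preimage hsrc
  have hcov : O ∪ Cᶜ = Set.univ := by
    refine Set.eq_univ_of_forall fun γ => ?_
    by_cases h : γ ∈ C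
    · obtain ⟨β, hβ, hβγ⟩ := h
      left
      change src γ ∈ e.target
      rw [← hβγ, he]
      exact e.map_source (hg hβ)
    · exact Or.inr h
  have hk0 : Set.EqOn k 0 Cᶜ := by
    intro γ hγ
    by_contra hne
    have hγO : γ ∈ O := Set.mem_of_indicator_ne_zero hne
    have h1 : k γ = divKernel f γ (e.symm (src γ)) * g (e.symm (src γ)) :=
      Set.indicator_of_mem hγO _
    have h2 : g (e.symm (src γ)) ≠ 0 := fun h => hne (by rw [h1, h, mul_zero]; rfl)
    exact hγ ⟨_, subset_tsupport _ h2, hs _ hγO⟩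
  have hkc : Continuous k := by
    rw [← continuousOn_univ, ← hcov]
    refine ContinuousOn.union_of_isOpen ?_ ?_ hO hC.isOpen_compl
    · have h1 := continuousOn_divKernel f.continuous e.continuousOn_symm hs
      have h2 : ContinuousOn (fun γ => g (e.symm (src γ))) O :=
        g.continuous.comp_continuousOn
          (e.continuousOn_symm.comp hsrc.continuousOn fun γ hγ => hγ)
      exact (h1.mul h2).congr (Set.eqOn_indicator)
    · exact continuousOn_const.congr hk0
  have hks : HasCompactSupport k := by
    refine HasCompactSupport.intro (isCompact_products f.hasCompactSupport.isCompact
      g.hasCompactSupport.isCompact) fun γ hγ => ?_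
    by_contra hne
    have hγO : γ ∈ O := Set.mem_of_indicator_ne_zero hne
    have h1 : k γ = divKernel f γ (e.symm (src γ)) * g (e.symm (src γ)) :=
      Set.indicator_of_mem hγO _
    have hd : src γ = rng (inverse (e.symm (src γ))) := (hs _ hγO).symm
    rw [h1, divKernel, dif_pos hd] at hne
    exact hγ ⟨_, subset_tsupport _ (left_ne_zero_of_mul hne), _,
      subset_tsupport _ (right_ne_zero_of_mul hne), rfl, prod_div_cancel _ _ hd⟩
  refine ⟨⟨⟨k, hkc⟩, hks⟩, fun γ => ?_⟩
  change HasSum _ (k γ)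
  by_cases hγ : γ ∈ O
  · have h1 : k γ = divKernel f γ (e.symm (src γ)) * g (e.symm (src γ)) :=
      Set.indicator_of_mem hγ _
    obtain ⟨β, hβ⟩ : ∃ β : Quiver.Star γ.left, e.symm (src γ) = ⟨γ.left, β.1, β.2⟩ := by
      have h2 := hs _ hγ
      revert h2
      generalize e.symm (src γ) = δ
      obtain ⟨x, y, d⟩ := δ
      rintro rfl
      exact ⟨⟨y, d⟩, rfl⟩
    rw [h1, hβ, divKernel_of_star]
    refine hasSum_single (f := fun β : Quiver.Star γ.left =>
        f ⟨β.1, γ.right, Groupoid.inv β.2 ≫ γ.hom⟩ * g ⟨γ.left, β.1, β.2⟩) β fun β' hβ' => ?_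
    refine mul_eq_zero_of_right _ (by_contra fun hne => hβ' ?_)
    have h3 := (hσ _ hne).2.symm.trans hβ
    obtain ⟨y, b⟩ := β
    obtain ⟨y', b'⟩ := β'
    cases h3
    rfl
  · rw [show k γ = 0 from Set.indicator_of_notMem hγ _]
    convert hasSum_zero with β
    refine mul_eq_zero_of_right _ (by_contra fun hne => hγ (hσ _ hne).1)

/-- A compactly supported function is a finite sum of functions supported in open bisections. -/
theorem exists_sum_bisections [LocallyCompactSpace (Arrows X)] [IsEtaleGroupoid X]
    (g : C_c(Arrows X, ℂ)) :
    ∃ (n : ℕ) (G : Fin n → C_c(Arrows X, ℂ)) (e : Fin n → OpenPartialHomeomorph (Arrows X) X),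
      (∀ j, src = e j ∧ tsupport (G j) ⊆ (e j).source) ∧ ∀ γ, g γ = ∑ j, G j γ := by
  choose E hE hEs using isLocalHomeomorph_src X
  obtain ⟨t, ht⟩ := g.hasCompactSupport.isCompact.elim_finite_subcover (fun γ => (E γ).source)
    (fun γ => (E γ).open_source) (fun γ _ => Set.mem_iUnion.2 ⟨γ, hE γ⟩)
  let e : Fin t.card → OpenPartialHomeomorph (Arrows X) X := fun j => E (t.equivFin.symm j)
  have hcov : tsupport g ⊆ ⋃ j, (e j).source := fun γ hγ => by
    obtain ⟨δ, hδ, h⟩ := Set.mem_iUnion₂.1 (ht hγ)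
    exact Set.mem_iUnion.2 ⟨t.equivFin ⟨δ, hδ⟩, by simpa [e] using h⟩
  obtain ⟨φ, hφ, hsum, -, -⟩ := exists_continuous_sum_one_of_isOpen_isCompact
    (fun j => (e j).open_source) g.hasCompactSupport.isCompact hcov
  refine ⟨t.card, fun j => ⟨⟨fun γ => (φ j γ : ℂ) * g γ, by fun_prop⟩,
    g.hasCompactSupport.mul_left⟩, e, fun j => ⟨hEs _, ?_⟩, fun γ => ?_⟩
  · refine (closure_mono fun γ hγ => ?_).trans (hφ j)
    exact fun h => hγ (by simp [h])
  · change g γ = ∑ j, (φ j γ : ℂ) * g γ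
    rw [← Finset.sum_mul, ← Complex.ofReal_sum]
    by_cases hγ : γ ∈ tsupport g
    · have := hsum hγ
      simp only [Finset.sum_apply, Pi.one_apply] at this
      simp [this]
    · simp [image_eq_zero_of_notMem_tsupport hγ]

/-- `C_c(𝒢)` is closed under convolution. -/
theorem exists_convolution [LocallyCompactSpace (Arrows X)] [IsEtaleGroupoid X]
    (f g : C_c(Arrows X, ℂ)) :
    ∃ k : C_c(Arrows X, ℂ), ∀ γ : Arrows X,
      HasSum (fun β : Quiver.Star γ.left =>
        f ⟨β.1, γ.right, Groupoid.inv β.2 ≫ γ.hom⟩ * g ⟨γ.left, β.1, β.2⟩) (k γ) := by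
  obtain ⟨n, G, e, hG, hsum⟩ := exists_sum_bisections g
  choose k hk using fun j => exists_convolution_of_bisection f (G j) (e j) (hG j).1 (hG j).2
  refine ⟨∑ j, k j, fun γ => ?_⟩
  simp only [hsum, Finset.mul_sum, CompactlySupportedContinuousMap.sum_apply]
  exact hasSum_sum fun j _ => hk j γ

end Convolution

/-! ### Matrix coefficients -/

section Matrix

variable {X : Type u} [Groupoid.{v} X]

theorem delta_apply_self {x : X} (γ : Quiver.Star x) : (delta γ : FibreSpace x) γ = 1 := by
  simp [delta]

theorem delta_apply_of_ne {x : X} {α γ : Quiver.Star x} (h : γ ≠ α) :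
    (delta α : FibreSpace x) γ = 0 := by
  simp [delta, h]

theorem norm_delta {x : X} (γ : Quiver.Star x) : ‖(delta γ : FibreSpace x)‖ = 1 := by
  classical
  simp [delta, lp.norm_single]

theorem inner_delta_left {x : X} (γ : Quiver.Star x) (η : FibreSpace x) :
    inner ℂ (delta γ) η = η γ := by
  classical
  have := lp.inner_single_left (𝕜 := ℂ) (G := fun _ : Quiver.Star x => ℂ) γ (1 : ℂ) η
  simpa [delta] using this

/-- Two arrows out of `x` are equal if their quotients by a third arrow out of `x` are. -/
theorem star_eq_of_div_eq {x : X} {α β γ : Quiver.Star x}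
    (h : (⟨α.1, γ.1, Groupoid.inv α.2 ≫ γ.2⟩ : Arrows X) =
      ⟨β.1, γ.1, Groupoid.inv β.2 ≫ γ.2⟩) : α = β := by
  obtain ⟨a, α⟩ := α
  obtain ⟨b, β⟩ := β
  obtain rfl : a = b := congrArg src h
  have h' : Groupoid.inv α ≫ γ.2 = Groupoid.inv β ≫ γ.2 := by injection h
  have h'' : α = β := by
    simpa only [Groupoid.inv_eq_inv, cancel_mono, IsIso.inv_eq_inv] using h'
  rw [h'']

variable {x : X}

/-- The matrix expansion of a bounded operator on `ℓ²(𝒢_x)`. -/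
theorem hasSum_apply (T : FibreSpace x →L[ℂ] FibreSpace x) (ξ : FibreSpace x)
    (γ : Quiver.Star x) : HasSum (fun α => ξ α * T (delta α) γ) (T ξ γ) := by
  classical
  have h := lp.hasSum_single (p := 2) (by simp) ξ
  have h' := ((lp.evalCLM ℂ (fun _ : Quiver.Star x => ℂ) 2 γ).comp T).hasSum h
  refine Eq.subst (motive := fun F => HasSum F (T ξ γ)) (funext fun α => ?_) h'
  have hs : lp.single 2 α (ξ α) = ξ α • (delta α : FibreSpace x) := by
    rw [delta, ← lp.single_smul, smul_eq_mul, mul_one]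
  change T (lp.single 2 α (ξ α)) γ = _
  rw [hs, map_smul]
  rfl

theorem norm_apply_delta_le (T : FibreOperators X) (α γ : Quiver.Star x) :
    ‖T.at x (delta α) γ‖ ≤ ‖T‖ :=
  calc ‖T.at x (delta α) γ‖ ≤ ‖T.at x (delta α)‖ := lp.norm_apply_le_norm (by simp) _ _
    _ ≤ ‖T.at x‖ * ‖(delta α : FibreSpace x)‖ := (T.at x).le_opNorm _
    _ = ‖T.at x‖ := by rw [norm_delta, mul_one]
    _ ≤ ‖T‖ := lp.norm_apply_le_norm (E := fun x : X => FibreSpace x →L[ℂ] FibreSpace x)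
      (by simp) T x

theorem norm_apply_delta_sub_le (S T : FibreOperators X) {x : X} (α γ : Quiver.Star x) :
    ‖S.at x (delta α) γ - T.at x (delta α) γ‖ ≤ ‖S - T‖ :=
  norm_apply_delta_le (S - T) α γ

theorem adjoint_apply_delta (T : FibreSpace x →L[ℂ] FibreSpace x) (α γ : Quiver.Star x) :
    ContinuousLinearMap.adjoint T (delta α) γ = star (T (delta γ) α) := by
  rw [← inner_delta_left, ContinuousLinearMap.adjoint_inner_right, ← inner_conj_symm,
    inner_delta_left]
  rfl

/-- A family of multiplication operators is determined by its matrix coefficients. -/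
theorem isMultiplication_of_delta {f : X → ℂ} {T : FibreOperators X}
    (h : ∀ (x : X) (α : Quiver.Star x), T.at x (delta α) α = f α.1)
    (h0 : ∀ (x : X) (α γ : Quiver.Star x), γ ≠ α → T.at x (delta α) γ = 0) :
    IsMultiplication f T := by
  intro x ξ γ
  refine (hasSum_apply (T.at x) ξ γ).unique ?_
  have := hasSum_single (f := fun α => ξ α * T.at x (delta α) γ) γ
    fun α hα => by rw [h0 x α γ hα.symm, mul_zero]
  rwa [h, mul_comm] at this

theorem IsMultiplication.apply_delta {f : X → ℂ} {T : FibreOperators X}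
    (h : IsMultiplication f T) (α : Quiver.Star x) : T.at x (delta α) = f α.1 • delta α := by
  refine lp.ext (funext fun γ => ?_)
  rw [h x]
  by_cases hγ : γ = α
  · subst hγ; rfl
  · simp [delta_apply_of_ne hγ]

/-- The matrix coefficients of `a* f a` are sums over the fibre. -/
theorem IsMultiplication.hasSum_conj {f : X → ℂ} {D : FibreOperators X}
    (hD : IsMultiplication f D) (T : FibreOperators X) (α γ : Quiver.Star x) :
    HasSum (fun β => Star.star (T.at x (delta γ) β) * (f β.1 * T.at x (delta α) β))
      ((Star.star T * D * T).at x (delta α) γ) := by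
  have h := lp.hasSum_inner (𝕜 := ℂ) (T.at x (delta γ)) (D.at x (T.at x (delta α)))
  have h1 : (Star.star T * D * T).at x (delta α) γ =
      inner ℂ (T.at x (delta γ)) (D.at x (T.at x (delta α))) := by
    rw [← inner_delta_left, ← ContinuousLinearMap.adjoint_inner_right]
    rfl
  rw [h1]
  refine Eq.subst (motive := fun F => HasSum F (inner ℂ _ _)) (funext fun β => ?_) h
  rw [hD x, RCLike.inner_apply, mul_comm]
  rfl

/-! ### Families of operators given by functions on the groupoid -/

theorem IsRegularRep.add {f g : Arrows X → ℂ} {S T : FibreOperators X} (hS : IsRegularRep f S)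
    (hT : IsRegularRep g T) : IsRegularRep (f + g) (S + T) := fun x α γ =>
  congrArg₂ (· + ·) (hS x α γ) (hT x α γ)

theorem IsRegularRep.smul {f : Arrows X → ℂ} {T : FibreOperators X} (c : ℂ)
    (hT : IsRegularRep f T) : IsRegularRep (c • f) (c • T) := fun x α γ =>
  congrArg (c * ·) (hT x α γ)

theorem IsRegularRep.star {f : Arrows X → ℂ} {T : FibreOperators X} (hT : IsRegularRep f T) :
    IsRegularRep (fun γ => star (f (inverse γ))) (star T) := by
  intro x α γ
  rw [FibreOperators.star_at, adjoint_apply_delta, hT]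
  simp [inverse]

/-- Translation by `α⁻¹` identifies the arrows with the source of `α` and those with the range. -/
def starEquiv {x : X} (α : Quiver.Star x) : Quiver.Star x ≃ Quiver.Star α.1 where
  toFun β := ⟨β.1, Groupoid.inv α.2 ≫ β.2⟩
  invFun β := ⟨β.1, α.2 ≫ β.2⟩
  left_inv β := by simp
  right_inv β := by simp

/-- Composition of operators corresponds to convolution: if the convolution sums of `f` and `g`
converge to `k`, then the product acts by `k`. -/
theorem IsRegularRep.mul {f g k : Arrows X → ℂ} {S T : FibreOperators X} (hS : IsRegularRep f S)
    (hT : IsRegularRep g T)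
    (hk : ∀ γ : Arrows X, HasSum (fun β : Quiver.Star γ.left =>
        f ⟨β.1, γ.right, Groupoid.inv β.2 ≫ γ.hom⟩ * g ⟨γ.left, β.1, β.2⟩) (k γ)) :
    IsRegularRep k (S * T) := by
  intro x α γ
  refine (hasSum_apply (S.at x) (T.at x (delta α)) γ).unique ?_
  have h := (starEquiv α).hasSum_iff.2 (hk ⟨α.1, γ.1, Groupoid.inv α.2 ≫ γ.2⟩)
  convert h using 2 with β
  simp [hS x β γ, hT x α β, starEquiv, mul_comm]

end Matrix

/-! ### Elements of the reduced C*-algebra -/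

section Reduced

variable {X : Type u} [Groupoid.{v} X] [TopologicalSpace (Arrows X)]

theorem IsRegularRep.coeff_eq {f : Arrows X → ℂ} {a : ReducedCStarAlgebra X}
    (h : IsRegularRep f (a : FibreOperators X)) : coeff a = f := by
  funext γ
  refine (h γ.left ⟨γ.left, 𝟙 γ.left⟩ ⟨γ.right, γ.hom⟩).trans ?_
  simp

variable [TopologicalSpace X] [T2Space (Arrows X)] [IsEtaleGroupoid X]

/-- A compactly supported continuous function on the unit space acts by an element of the
diagonal, since the unit space is open in the groupoid. -/
theorem exists_mem_diagonal (f : C_c(X, ℂ)) :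
    ∃ d ∈ diagonal X, IsMultiplication f (d : FibreOperators X) := by
  classical
  have := t2Space_units (X := X)
  obtain ⟨C, hC⟩ := f.hasCompactSupport.exists_bound_of_continuous f.continuous
  have hC' : ∀ x, ‖f x‖ ≤ ‖(C : ℂ)‖ := fun x => by
    rw [Complex.norm_real]
    exact (hC x).trans (le_abs_self C)
  have hle : ∀ (x : X) (ξ : FibreSpace x) (γ : Quiver.Star x),
      ‖f γ.1 * ξ γ‖ ≤ ‖((C : ℂ) • ξ) γ‖ := fun x ξ γ => by
    rw [lp.coeFn_smul, Pi.smul_apply, smul_eq_mul, norm_mul, norm_mul]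
    exact mul_le_mul_of_nonneg_right (hC' _) (norm_nonneg _)
  let M : ∀ x : X, FibreSpace x →ₗ[ℂ] FibreSpace x := fun x =>
    { toFun := fun ξ => ⟨fun γ => f γ.1 * ξ γ, ((lp.memℓp ((C : ℂ) • ξ)).norm).mono (hle x ξ)⟩
      map_add' := fun ξ η => lp.ext (funext fun γ => mul_add (f γ.1) (ξ γ) (η γ))
      map_smul' := fun c ξ => lp.ext (funext fun γ => mul_left_comm (f γ.1) c (ξ γ)) }
  have hM : ∀ (x : X) (ξ : FibreSpace x), ‖M x ξ‖ ≤ ‖(C : ℂ)‖ * ‖ξ‖ := fun x ξ => by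
    rw [← norm_smul]
    exact lp.norm_mono (by simp) (hle x ξ)
  let T : FibreOperators X := show lp (fun x : X => FibreSpace x →L[ℂ] FibreSpace x) ∞ from
    ⟨fun x => (M x).mkContinuous ‖(C : ℂ)‖ (hM x), memℓp_infty ⟨‖(C : ℂ)‖, by
      rintro _ ⟨x, rfl⟩
      exact (M x).mkContinuous_norm_le (norm_nonneg _) _⟩⟩
  have hT : IsMultiplication f T := fun x ξ γ => rfl
  have hemb := isOpenEmbedding_unit X
  have hsrc : Continuous (src : Arrows X → X) := IsTopologicalGroupoid.continuous_src
  let U : Set (Arrows X) := {γ | unit (src γ) = γ}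
  have hU : IsClopen U := by
    refine ⟨isClosed_eq (hemb.continuous.comp hsrc) continuous_id, ?_⟩
    convert hemb.isOpen_range using 1
    ext γ
    exact ⟨fun h => ⟨_, h⟩, by rintro ⟨x, rfl⟩; rfl⟩
  let F : Arrows X → ℂ := U.indicator fun γ => f (src γ)
  have hFc : Continuous F := hU.continuous_indicator (f.continuous.comp hsrc)
  have hFs : HasCompactSupport F := by
    refine HasCompactSupport.intro (f.hasCompactSupport.isCompact.image hemb.continuous)
      fun γ hγ => ?_
    by_contra hne
    have hγU : γ ∈ U := Set.mem_of_indicator_ne_zero hne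
    refine hγ ⟨src γ, subset_tsupport _ fun h0 => hne ?_, hγU⟩
    rw [← h0]
    exact Set.indicator_of_mem hγU fun γ => f (src γ)
  have hF : IsRegularRep (⟨⟨F, hFc⟩, hFs⟩ : C_c(Arrows X, ℂ)) T := by
    intro x α γ
    rw [hT.apply_delta]
    change f α.1 * (delta α : FibreSpace x) γ = F _
    by_cases hγ : γ = α
    · subst hγ
      have hu : (⟨γ.1, γ.1, Groupoid.inv γ.2 ≫ γ.2⟩ : Arrows X) ∈ U := by
        simp [U, unit, src]
      rw [delta_apply_self, mul_one]
      exact (Set.indicator_of_mem hu fun γ => f (src γ)).symm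
    · rw [delta_apply_of_ne hγ, mul_zero]
      refine (Set.indicator_of_notMem (fun hu => hγ ?_) fun γ => f (src γ)).symm
      obtain ⟨y, α⟩ := α
      obtain ⟨z, γ⟩ := γ
      obtain rfl : y = z := congrArg rng hu
      have h' : 𝟙 y = Groupoid.inv α ≫ γ := by injection hu
      have h'' : γ = α := by
        simpa using (congrArg (α ≫ ·) h').symm
      rw [h'']
  have hmem : T ∈ ReducedCStarAlgebra X :=
    NonUnitalStarSubalgebra.le_topologicalClosure _
      (NonUnitalStarAlgebra.subset_adjoin ℂ _ ⟨_, hF⟩)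
  exact ⟨⟨T, hmem⟩, ⟨(f : C₀(X, ℂ)), hT⟩, hT⟩

variable [LocallyCompactSpace (Arrows X)]

variable (X) in
/-- The operators given by compactly supported continuous functions; they already form a
`*`-algebra under convolution. -/
noncomputable def compactlySupportedAlgebra : NonUnitalStarSubalgebra ℂ (FibreOperators X) where
  carrier := {T | ∃ f : C_c(Arrows X, ℂ), IsRegularRep f T}
  add_mem' := by
    rintro S T ⟨f, hf⟩ ⟨g, hg⟩
    exact ⟨f + g, hf.add hg⟩
  zero_mem' := ⟨0, fun _ _ _ => rfl⟩
  mul_mem' := by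
    rintro S T ⟨f, hf⟩ ⟨g, hg⟩
    obtain ⟨k, hk⟩ := exists_convolution f g
    exact ⟨k, hf.mul hg hk⟩
  smul_mem' := by
    rintro c T ⟨f, hf⟩
    exact ⟨c • f, hf.smul c⟩
  star_mem' := by
    rintro T ⟨f, hf⟩
    have hinv : Continuous (inverse : Arrows X → Arrows X) :=
      IsTopologicalGroupoid.continuous_inverse
    refine ⟨⟨⟨fun γ => Star.star (f (inverse γ)), (f.continuous.comp hinv).star⟩, ?_⟩, hf.star⟩
    refine HasCompactSupport.intro (f.hasCompactSupport.isCompact.image hinv) fun γ hγ => ?_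
    have : f (inverse γ) = 0 := by
      by_contra hne
      exact hγ ⟨_, subset_tsupport _ hne, inverse_inverse γ⟩
    simp [this]

/-- Compactly supported functions are dense in the reduced C*-algebra: no products or adjoints have
to be adjoined. -/
theorem exists_norm_sub_lt (a : ReducedCStarAlgebra X) {ε : ℝ} (hε : 0 < ε) :
    ∃ (f : C_c(Arrows X, ℂ)) (T : FibreOperators X),
      IsRegularRep f T ∧ ‖(a : FibreOperators X) - T‖ < ε := by
  have h : (a : FibreOperators X) ∈ closure (NonUnitalStarAlgebra.adjoin ℂ
    {T : FibreOperators X | ∃ f : C_c(Arrows X, ℂ), IsRegularRep f T} : Set (FibreOperators X)) :=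
    a.2
  obtain ⟨T, hT, hd⟩ := Metric.mem_closure_iff.1 h ε hε
  obtain ⟨f, hf⟩ := (NonUnitalStarAlgebra.adjoin_le
    (S := compactlySupportedAlgebra X) fun T hT => hT) hT
  exact ⟨f, T, hf, by rwa [← dist_eq_norm]⟩

/-- Every element acts by left convolution by its coefficient function. -/
theorem isRegularRep_coeff (a : ReducedCStarAlgebra X) :
    IsRegularRep (coeff a) (a : FibreOperators X) := by
  intro x α γ
  refine eq_of_forall_dist_le fun ε hε => ?_
  obtain ⟨f, T, hf, hT⟩ := exists_norm_sub_lt a (half_pos hε)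
  have h1 := norm_apply_delta_sub_le (a : FibreOperators X) T α γ
  have h2 := norm_apply_delta_sub_le (a : FibreOperators X) T (x := α.1) ⟨α.1, 𝟙 _⟩
    ⟨γ.1, Groupoid.inv α.2 ≫ γ.2⟩
  have h3 : T.at α.1 (delta ⟨α.1, 𝟙 _⟩) ⟨γ.1, Groupoid.inv α.2 ≫ γ.2⟩ =
      T.at x (delta α) γ := by
    rw [hf, hf]
    simp
  rw [h3, ← dist_eq_norm] at h2
  rw [← dist_eq_norm] at h1
  change dist _ ((a : FibreOperators X).at α.1 (delta ⟨α.1, 𝟙 _⟩)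
    ⟨γ.1, Groupoid.inv α.2 ≫ γ.2⟩) ≤ ε
  linarith [dist_triangle_right ((a : FibreOperators X).at x (delta α) γ)
    ((a : FibreOperators X).at α.1 (delta ⟨α.1, 𝟙 _⟩) ⟨γ.1, Groupoid.inv α.2 ≫ γ.2⟩)
    (T.at x (delta α) γ)]

/-- The restriction of the coefficient function to the units, as an element of `C₀(𝒢⁽⁰⁾)`. -/
noncomputable def coeffUnits (a : ReducedCStarAlgebra X) : C₀(X, ℂ) where
  toFun x := coeff a (unit x)
  continuous_toFun := by
    refine continuous_of_uniform_approx_of_continuous fun u hu => ?_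
    obtain ⟨ε, hε, hεu⟩ := Metric.mem_uniformity_dist.1 hu
    obtain ⟨f, T, hf, hT⟩ := exists_norm_sub_lt a hε
    refine ⟨fun x => f (unit x),
      f.continuous.comp IsTopologicalGroupoid.continuous_unit, fun x => hεu ?_⟩
    have := norm_apply_delta_sub_le (a : FibreOperators X) T (x := x) ⟨x, 𝟙 x⟩ ⟨x, 𝟙 x⟩
    rw [isRegularRep_coeff, hf] at this
    simpa [dist_eq_norm, unit] using this.trans_lt hT
  zero_at_infty' := by
    rw [Metric.tendsto_nhds]
    intro ε hε
    obtain ⟨f, T, hf, hT⟩ := exists_norm_sub_lt a hε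
    have hsrc : Continuous (src : Arrows X → X) := IsTopologicalGroupoid.continuous_src
    filter_upwards [(f.hasCompactSupport.isCompact.image hsrc).compl_mem_cocompact] with x hx
    have h0 : f (unit x) = 0 := by
      by_contra hne
      exact hx ⟨_, subset_tsupport _ hne, rfl⟩
    have := norm_apply_delta_sub_le (a : FibreOperators X) T (x := x) ⟨x, 𝟙 x⟩ ⟨x, 𝟙 x⟩
    rw [isRegularRep_coeff, hf] at this
    simp only [unit] at h0
    simpa [dist_eq_norm, unit, h0] using this.trans_lt hT

theorem coeff_star (a : ReducedCStarAlgebra X) (γ : Arrows X) :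
    coeff (star a) γ = star (coeff a (inverse γ)) :=
  congrFun (IsRegularRep.coeff_eq (a := star a) (isRegularRep_coeff a).star) γ

end Reduced

/-! ### Normalizers and sections -/

section Normalizers

variable {X : Type u} [Groupoid.{v} X] [TopologicalSpace X] [TopologicalSpace (Arrows X)]
  [T2Space (Arrows X)] [LocallyCompactSpace (Arrows X)] [IsEtaleGroupoid X]

/-- Here `a* d a` has no coefficients off the diagonal of any fibre, so it is multiplication by the
restriction of its coefficient function to the units. -/
theorem isRNormalizer_of_isRSection {a : ReducedCStarAlgebra X}
    (ha : IsRSection (openSupport a)) : IsRNormalizer (diagonal X) a := by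
  rintro d ⟨f, hf⟩
  set b : ReducedCStarAlgebra X := star a * d * a with hb
  refine ⟨coeffUnits b, isMultiplication_of_delta (fun x α => ?_) fun x α γ hγ => ?_⟩
  · rw [isRegularRep_coeff]
    simp [coeffUnits, unit]
  · have h := hf.hasSum_conj (a : FibreOperators X) α γ
    refine h.unique ?_
    convert hasSum_zero with β
    rw [isRegularRep_coeff, isRegularRep_coeff]
    by_contra hne
    -- Both quotients `β γ⁻¹` and `β α⁻¹` lie in the open support and have the same range.
    have h1 := star_ne_zero.1 (left_ne_zero_of_mul hne)
    have h2 := right_ne_zero_of_mul (right_ne_zero_of_mul hne)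
    exact hγ (star_eq_of_div_eq (ha h1 h2 rfl))

/-- Letting `d` run through functions that concentrate at `r(β)` isolates the term of `β` in the
sum for the coefficient of `a* d a`. -/
theorem mul_coeff_eq_zero_of_isRNormalizer (hX : IsPrincipal X) {a : ReducedCStarAlgebra X}
    (ha : IsRNormalizer (diagonal X) a) {x : X} {α γ : Quiver.Star x} (hγ : γ ≠ α)
    (β : Quiver.Star x) :
    star ((a : FibreOperators X).at x (delta γ) β) * (a : FibreOperators X).at x (delta α) β
      = 0 := by
  classical
  have := t2Space_units (X := X)
  have := locallyCompactSpace_units (X := X)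
  set c : Quiver.Star x → ℂ := fun β =>
    star ((a : FibreOperators X).at x (delta γ) β) * (a : FibreOperators X).at x (delta α) β
    with hc
  -- Principality makes the range map injective on the arrows with source `x`.
  have hinj : ∀ β' : Quiver.Star x, β'.1 = β.1 → β' = β := by
    rintro ⟨y, b'⟩ h
    obtain ⟨z, b⟩ := β
    obtain rfl : y = z := h
    have h' : (⟨x, y, b'⟩ : Arrows X) = ⟨x, y, b⟩ := hX rfl
    cases h'
    rfl
  have hsum : Summable fun β => ‖c β‖ := by
    have h := (lp.summable_inner (𝕜 := ℂ) ((a : FibreOperators X).at x (delta γ))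
      ((a : FibreOperators X).at x (delta α))).norm
    simpa [hc, RCLike.inner_apply, mul_comm] using h
  by_contra hne
  have hpos : 0 < ‖c β‖ := norm_pos_iff.2 hne
  -- Off a finite set `s` the terms sum to at most half of the term at `β`; a bump function `φ`
  -- that is `1` at `r(β)` and `0` at the ranges of the other arrows in `s` gives a contradiction.
  obtain ⟨s, hs⟩ := summable_iff_vanishing_norm.1 hsum _ (half_pos hpos)
  obtain ⟨φ, hφ1, hφ0, hφs, hφI⟩ := exists_continuous_one_zero_of_isCompact
    (s := {β.1}) (t := ((s.erase β).image Sigma.fst : Finset X)) isCompact_singleton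
    (Finset.finite_toSet _).isClosed (by
      rw [Set.disjoint_singleton_left]
      intro h
      obtain ⟨β', hβ', h'⟩ := Finset.mem_image.1 h
      exact (Finset.mem_erase.1 hβ').1 (hinj β' h'))
  let f : C_c(X, ℂ) := ⟨⟨fun y => (φ y : ℂ), by fun_prop⟩, hφs.comp_left Complex.ofReal_zero⟩
  obtain ⟨d, hd, hdf⟩ := exists_mem_diagonal f
  obtain ⟨g, hg⟩ := ha d hd
  have h := hdf.hasSum_conj (a : FibreOperators X) α γ
  have h0 : (star (a : FibreOperators X) * (d : FibreOperators X) *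
      (a : FibreOperators X)).at x (delta α) γ = 0 := by
    refine (hg x (delta α) γ).trans ?_
    rw [delta_apply_of_ne hγ, mul_zero]
  rw [h0] at h
  have h' : HasSum (fun β' => (φ β'.1 : ℂ) * c β') 0 := by
    convert h using 2 with β'
    exact mul_left_comm _ _ _
  have hw := h'.sub (hasSum_ite_eq β (c β))
  have hφβ : φ β.1 = 1 := hφ1 rfl
  set w : Quiver.Star x → ℂ := fun β' => φ β'.1 * c β' - if β' = β then c β else 0 with hwdef
  have hws : ∀ β' ∈ s, w β' = 0 := fun β' hβ' => by
    by_cases h : β' = β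
    · subst h
      simp [hwdef, hφβ]
    · have : φ β'.1 = 0 := hφ0 (Finset.mem_coe.2 (Finset.mem_image_of_mem _
        (Finset.mem_erase.2 ⟨h, hβ'⟩)))
      simp [hwdef, h, this]
  have hwc : ∀ β', ‖w β'‖ ≤ ‖c β'‖ := fun β' => by
    by_cases h : β' = β
    · subst h
      simp [hwdef, hφβ]
    · simp only [hwdef, h, if_false, sub_zero, norm_mul, Complex.norm_real, Real.norm_eq_abs,
        abs_of_nonneg (hφI β'.1).1]
      exact mul_le_of_le_one_left (norm_nonneg _) (hφI β'.1).2
  have hbound : ∀ t : Finset (Quiver.Star x), ‖∑ β' ∈ t, w β'‖ ≤ ‖c β‖ / 2 := fun t =>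
    calc ‖∑ β' ∈ t, w β'‖ = ‖∑ β' ∈ t \ s, w β'‖ := by
          congr 1
          refine (Finset.sum_subset Finset.sdiff_subset fun β' hβ' hn => hws β' ?_).symm
          simpa [hβ'] using hn
      _ ≤ ∑ β' ∈ t \ s, ‖w β'‖ := norm_sum_le _ _
      _ ≤ ∑ β' ∈ t \ s, ‖c β'‖ := Finset.sum_le_sum fun β' _ => hwc β'
      _ ≤ ‖∑ β' ∈ t \ s, ‖c β'‖‖ := le_abs_self _
      _ ≤ ‖c β‖ / 2 := (hs _ Finset.sdiff_disjoint).le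
  have hlim := le_of_tendsto' ((continuous_norm.tendsto _).comp hw) hbound
  rw [zero_sub, norm_neg] at hlim
  linarith

theorem isRSection_of_isRNormalizer (hX : IsPrincipal X) {a : ReducedCStarAlgebra X}
    (ha : IsRNormalizer (diagonal X) a) : IsRSection (openSupport a) := by
  rintro ⟨x, y, b⟩ h1 ⟨x', y', b'⟩ h2 (rfl : y = y')
  by_contra hne
  -- In `𝒢_x`, the second arrow is the quotient of `b` by `γ = b'⁻¹ b`.
  let α : Quiver.Star x := ⟨x, 𝟙 x⟩
  let γ : Quiver.Star x := ⟨x', b ≫ Groupoid.inv b'⟩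
  let β : Quiver.Star x := ⟨y, b⟩
  have hα : (⟨α.1, β.1, Groupoid.inv α.2 ≫ β.2⟩ : Arrows X) = ⟨x, y, b⟩ := by simp [α, β]
  have hγ : (⟨γ.1, β.1, Groupoid.inv γ.2 ≫ β.2⟩ : Arrows X) = ⟨x', y, b'⟩ := by simp [γ, β]
  have hγα : γ ≠ α := fun h => hne (by rw [← hα, ← hγ, h])
  have h := mul_coeff_eq_zero_of_isRNormalizer hX ha hγα β
  rw [isRegularRep_coeff, isRegularRep_coeff, hα, hγ] at h
  exact mul_ne_zero (star_ne_zero.2 h2) h1 h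

theorem isRNormalizer_iff (hX : IsPrincipal X) (a : ReducedCStarAlgebra X) :
    IsRNormalizer (diagonal X) a ↔ IsRSection (openSupport a) :=
  ⟨isRSection_of_isRNormalizer hX, isRNormalizer_of_isRSection⟩

/-- The open support of `a*` consists of the inverses of the arrows in that of `a`. -/
theorem isRSection_openSupport_star (a : ReducedCStarAlgebra X) :
    IsRSection (openSupport (star a)) ↔ IsSSection (openSupport a) := by
  have h : ∀ γ, γ ∈ openSupport (star a) ↔ inverse γ ∈ openSupport a := fun γ => by
    simp [openSupport, coeff_star]
  constructor
  · intro ha γ hγ δ hδ hs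
    rw [← inverse_inverse γ, ← h] at hγ
    rw [← inverse_inverse δ, ← h] at hδ
    have := congrArg inverse (ha hγ hδ hs)
    rwa [inverse_inverse, inverse_inverse] at this
  · intro ha γ hγ δ hδ hr
    have := congrArg inverse (ha ((h γ).1 hγ) ((h δ).1 hδ) hr)
    rwa [inverse_inverse, inverse_inverse] at this

end Normalizers

end EtaleGpd

theorem mainTheorem4 (X : Type u) [Groupoid.{v} X] [TopologicalSpace X]
    [TopologicalSpace (EtaleGpd.Arrows X)] [T2Space (EtaleGpd.Arrows X)]
    [LocallyCompactSpace (EtaleGpd.Arrows X)] [EtaleGpd.IsEtaleGroupoid X]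
    (hX : EtaleGpd.IsPrincipal X) (a : EtaleGpd.ReducedCStarAlgebra X) :
    (IsRNormalizer (EtaleGpd.diagonal X) a ↔ EtaleGpd.IsRSection (EtaleGpd.openSupport a)) ∧
    (IsSNormalizer (EtaleGpd.diagonal X) a ↔ EtaleGpd.IsSSection (EtaleGpd.openSupport a)) := by
  refine ⟨EtaleGpd.isRNormalizer_iff hX a, ?_⟩
  rw [← EtaleGpd.isRSection_openSupport_star, ← EtaleGpd.isRNormalizer_iff hX]
  simp only [IsSNormalizer, IsRNormalizer, star_star]
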